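/- Let $p\ge 1$ be a real number. For a group $G$ with a finite symmetric generating set $S$ (equipped with the word metric of $S$), let $D_p(G)$ be the space of functions $f\colon G\to\mathbb{C}$ with $\sum_{g\in G}|f(gs^{-1})-f(g)|^p<\infty$ for all $s\in S$, normed by $$\|f\|_{D_p}=\Bigl(\sum_{s\in S}\sum_{g\in G}|f(gs^{-1})-f(g)|^p+|f(e_G)|^p\Bigr)^{1/p},$$ and let $BD_p(G)$ be the algebra (under pointwise operations) of bounded functions in $D_p(G)$. Let $Sp(BD_p(G))$ be the set of characters of $BD_p(G)$, i.e. of nonzero algebra homomorphisms $BD_p(G)\to\mathbb{C}$, with the weak-$*$ topology, and let $i_G\colon G\to Sp(BD_p(G))$ be given by $i_G(g)(f)=f(g)$. The $p$-harmonic boundary $\partial_p(G)$ is the subspace of all $x\in Sp(BD_p(G))\setminus i_G(G)$ such that $x(f)=0$ for every bounded function $f$ in the $D_p$-closure of the finitely supported functions on $G$. A map $\phi\colon X\to Y$ of metric spaces is a rough isometry if there are constants $a\ge 1$, $b\ge 0$, $c>0$ such that $\frac1a d_X(x_1,x_2)-b\le d_Y(\phi(x_1),\phi(x_2))\le a\,d_X(x_1,x_2)+b$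 for all $x_1,x_2\in X$, and every $y\in Y$ satisfies $d_Y(\phi(x),y)<c$ for some $x\in X$. Theorem. Let $G$ and $H$ be finitely generated groups with finite symmetric generating sets $S$ and $T$, and let $\phi\colon G\to H$ be a rough isometry for the word metrics. Then $\partial_p(G)$ is homeomorphic to $\partial_p(H)$. More precisely, there is a homeomorphism $\bar\phi\colon\partial_p(G)\to\partial_p(H)$ such that for every $x\in\partial_p(G)$ and every sequence (more generally, every net or filter) of elements $g$ of $G$ with $i_G(g)\to x$ in $Sp(BD_p(G))$, one has $i_H(\phi(g))\to\bar\phi(x)$ in $Sp(BD_p(H))$. -/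

import Mathlib

open Filter Topology

noncomputable section

namespace PHarmonic

universe u

variable {G : Type u} [Group G]

/-- `S` is a finite symmetric generating set of the group `G`. -/
structure IsSymmGen (S : Finset G) : Prop where
  inv_mem : ∀ s ∈ S, s⁻¹ ∈ S
  closure_eq_top : Subgroup.closure (S : Set G) = ⊤

/-- The word metric: the graph distance in the Cayley graph, whose edges join `g` and `g * s`,
`s ∈ S`. -/
def wordDist (S : Finset G) (g h : G) : ℝ :=
  ((SimpleGraph.mulCayley (S : Set G)).dist g h : ℝ)

/-- `φ` is a rough isometry with respect to the distance functions `dX` and `dY`. -/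
def IsRoughIsometry {X Y : Type*} (dX : X → X → ℝ) (dY : Y → Y → ℝ) (φ : X → Y) : Prop :=
  (∃ a b : ℝ, 1 ≤ a ∧ 0 ≤ b ∧ ∀ x₁ x₂ : X,
    1 / a * dX x₁ x₂ - b ≤ dY (φ x₁) (φ x₂) ∧ dY (φ x₁) (φ x₂) ≤ a * dX x₁ x₂ + b) ∧
  ∃ c : ℝ, 0 < c ∧ ∀ y : Y, ∃ x : X, dY (φ x) y < c

/-- Membership in `D_p(G)`. -/
def MemDp (S : Finset G) (p : ℝ) (f : G → ℂ) : Prop :=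
  ∀ s ∈ S, Summable fun g : G => ‖f (g * s⁻¹) - f g‖ ^ p

/-- The norm of `D_p(G)`:
`(∑ s ∈ S, ∑ g, |f(g s⁻¹) - f(g)| ^ p + |f(e)| ^ p) ^ (1/p)`. -/
def dpNorm (S : Finset G) (p : ℝ) (f : G → ℂ) : ℝ :=
  ((∑ s ∈ S, ∑' g : G, ‖f (g * s⁻¹) - f g‖ ^ p) + ‖f 1‖ ^ p) ^ (1 / p)

/-- Membership in the closure, in `D_p(G)` with its norm, of the finitely supported functions. -/
def MemClosureFinSupp (S : Finset G) (p : ℝ) (f : G → ℂ) : Prop :=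
  MemDp S p f ∧ ∀ ε : ℝ, 0 < ε → ∃ u : G → ℂ, u.support.Finite ∧ dpNorm S p (f - u) < ε

theorem summable_norm_add {ι : Type*} {p : ℝ} (hp : 1 ≤ p) {a b : ι → ℂ}
    (ha : Summable fun i => ‖a i‖ ^ p) (hb : Summable fun i => ‖b i‖ ^ p) :
    Summable fun i => ‖a i + b i‖ ^ p := by
  have h0 : (ENNReal.ofReal p).toReal = p := ENNReal.toReal_ofReal (by linarith)
  have hpos : 0 < (ENNReal.ofReal p).toReal := by rw [h0]; linarith
  have ha' : Memℓp a (ENNReal.ofReal p) := by rw [memℓp_gen_iff hpos, h0]; exact ha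
  have hb' : Memℓp b (ENNReal.ofReal p) := by rw [memℓp_gen_iff hpos, h0]; exact hb
  have h := ha'.add hb'
  rw [memℓp_gen_iff hpos, h0] at h
  exact h

theorem summable_norm_mul {ι : Type*} {p : ℝ} (hp : 1 ≤ p) {a b : ι → ℂ} {C : ℝ}
    (ha : ∀ i, ‖a i‖ ≤ C) (hb : Summable fun i => ‖b i‖ ^ p) :
    Summable fun i => ‖a i * b i‖ ^ p := by
  refine Summable.of_nonneg_of_le (fun i => by positivity) (fun i => ?_) (hb.mul_left (C ^ p))
  rw [norm_mul, Real.mul_rpow (norm_nonneg _) (norm_nonneg _)]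
  exact mul_le_mul_of_nonneg_right
    (Real.rpow_le_rpow (norm_nonneg _) (ha i) (by linarith)) (by positivity)

/-- `BD_p(G)`: the algebra, under pointwise operations, of the bounded functions in `D_p(G)`. -/
def BD (S : Finset G) {p : ℝ} (hp : 1 ≤ p) : Subalgebra ℂ (G → ℂ) where
  carrier := {f | (∃ C : ℝ, ∀ g, ‖f g‖ ≤ C) ∧ MemDp S p f}
  add_mem' := by
    rintro f g ⟨⟨C, hC⟩, hf⟩ ⟨⟨C', hC'⟩, hg⟩
    refine ⟨⟨C + C', fun x => (norm_add_le _ _).trans (add_le_add (hC x) (hC' x))⟩, fun s hs => ?_⟩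
    refine (summable_norm_add hp (hf s hs) (hg s hs)).congr fun x => ?_
    simp only [Pi.add_apply]
    congr 2
    ring
  mul_mem' := by
    rintro f g ⟨⟨C, hC⟩, hf⟩ ⟨⟨C', hC'⟩, hg⟩
    refine ⟨⟨C * C', fun x => ?_⟩, fun s hs => ?_⟩
    · simp only [Pi.mul_apply, norm_mul]
      exact mul_le_mul (hC x) (hC' x) (norm_nonneg _) ((norm_nonneg _).trans (hC x))
    · refine (summable_norm_add hp
        (summable_norm_mul hp (fun x : G => hC (x * s⁻¹)) (hg s hs))
        (summable_norm_mul hp hC' (hf s hs))).congr fun x => ?_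
      simp only [Pi.mul_apply]
      congr 2
      ring
  algebraMap_mem' := by
    intro c
    refine ⟨⟨‖c‖, fun x => le_of_eq rfl⟩, fun s _ => ?_⟩
    have : p ≠ 0 := by linarith
    simp [Real.zero_rpow this]

/-- `Sp(BD_p(G))`: the characters of `BD_p(G)`, that is, its nonzero (multiplicative, `ℂ`-linear)
homomorphisms into `ℂ`. -/
def Spec (S : Finset G) {p : ℝ} (hp : 1 ≤ p) : Type u :=
  {τ : BD S hp →ₙₐ[ℂ] ℂ // τ ≠ 0}

/-- The weak-* topology: the coarsest one for which all evaluations `τ ↦ τ f` are continuous. -/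
instance (S : Finset G) {p : ℝ} (hp : 1 ≤ p) : TopologicalSpace (Spec S hp) :=
  TopologicalSpace.induced (fun τ (f : BD S hp) => τ.1 f) Pi.topologicalSpace

/-- The evaluation `f ↦ f g`, as a homomorphism. -/
def evalHom (S : Finset G) {p : ℝ} (hp : 1 ≤ p) (g : G) : BD S hp →ₙₐ[ℂ] ℂ where
  toFun f := (f : G → ℂ) g
  map_smul' _ _ := rfl
  map_zero' := rfl
  map_add' _ _ := rfl
  map_mul' _ _ := rfl

/-- The map `i : G → Sp(BD_p(G))`, `i(g)(f) = f(g)`. -/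
def toSpec (S : Finset G) {p : ℝ} (hp : 1 ≤ p) (g : G) : Spec S hp :=
  ⟨evalHom S hp g, fun h => one_ne_zero (α := ℂ) (DFunLike.congr_fun h (1 : BD S hp))⟩

/-- The `p`-harmonic boundary `∂_p(G)`, with the subspace topology of `Sp(BD_p(G))`. -/
def boundary (S : Finset G) {p : ℝ} (hp : 1 ≤ p) : Set (Spec S hp) :=
  {x | x ∉ Set.range (toSpec S hp) ∧
    ∀ f : BD S hp, MemClosureFinSupp S p (f : G → ℂ) → x.1 f = 0}

end PHarmonic

end

/-! Composition with a rough isometry `φ` carries `BD_p(H)` into `BD_p(G)`. Indeed `φ g` and `φ (g *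
s⁻¹)` differ by one of finitely many right translations, each costing at most a constant times the
energy (`exists_transEnergy_le`), and the fibres of `φ` are uniformly finite, so pulling back a sum
costs a constant factor (`tsum_comp_le_of_fiber`). Finite fibres also preserve finite supports,
hence the closure of the finitely supported functions. Dually, characters push forward continuously
and the boundary goes to the boundary. For a rough inverse `ψ`, the difference `f ∘ ψ ∘ φ - f` is in
`ℓ^p`, hence in that closure (`memClosureFinSupp_of_tsum_ne_top`), and boundary characters kill it.
So `φ` and `ψ` induce mutually inverse maps on the boundaries, though not necessarily on the
spectra. -/

open scoped ENNReal NNReal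

namespace PHarmonic

/-! ### Dirichlet energies and `ℓ^p` estimates -/

section Energy

variable {G : Type*} [Group G] {H : Type*} [Group H]

/-- The `p`-th power of the `ℓ^p` norm of the right difference of `F` along `w`. -/
noncomputable def transEnergy (p : ℝ) (w : G) (F : G → ℂ) : ℝ≥0∞ :=
  ∑' g : G, ‖F (g * w) - F g‖ₑ ^ p

/-- The `p`-Dirichlet energy, as an extended nonnegative real. -/
noncomputable def energy (S : Finset G) (p : ℝ) (F : G → ℂ) : ℝ≥0∞ :=
  ∑ s ∈ S, transEnergy p s⁻¹ F

/-- The `p`-th power of the norm of `D_p`, as an extended nonnegative real. -/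
noncomputable def normPow (S : Finset G) (p : ℝ) (F : G → ℂ) : ℝ≥0∞ :=
  energy S p F + ‖F 1‖ₑ ^ p

theorem enorm_sub_rpow_le {p : ℝ} (hp : 1 ≤ p) (a b c : ℂ) :
    ‖a - c‖ₑ ^ p ≤ ((2 : ℝ≥0) ^ (p - 1) : ℝ≥0) * (‖a - b‖ₑ ^ p + ‖b - c‖ₑ ^ p) := by
  have h : ‖a - c‖ₑ ≤ ‖a - b‖ₑ + ‖b - c‖ₑ := by
    rw [← sub_add_sub_cancel a b c]; exact enorm_add_le _ _
  refine (ENNReal.rpow_le_rpow h (by linarith)).trans ?_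
  refine (ENNReal.rpow_add_le_mul_rpow_add_rpow _ _ hp).trans_eq ?_
  rw [ENNReal.coe_rpow_of_ne_zero two_ne_zero]
  rfl

theorem tsum_enorm_sub_rpow_le {ι : Type*} {p : ℝ} (hp : 1 ≤ p) (a b c : ι → ℂ) :
    ∑' i, ‖a i - c i‖ₑ ^ p ≤
      ((2 : ℝ≥0) ^ (p - 1) : ℝ≥0) * (∑' i, ‖a i - b i‖ₑ ^ p + ∑' i, ‖b i - c i‖ₑ ^ p) := by
  rw [← ENNReal.tsum_add, ← ENNReal.tsum_mul_left]
  exact ENNReal.tsum_le_tsum fun i => enorm_sub_rpow_le hp _ _ _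

theorem transEnergy_one {p : ℝ} (hp : 1 ≤ p) (F : G → ℂ) : transEnergy p 1 F = 0 := by
  have : 0 < p := by linarith
  simp [transEnergy, this]

theorem transEnergy_inv (p : ℝ) (w : G) (F : G → ℂ) :
    transEnergy p w⁻¹ F = transEnergy p w F := by
  unfold transEnergy
  rw [← (Equiv.mulRight w).tsum_eq]
  refine tsum_congr fun g => ?_
  simp [enorm_sub_rev]

theorem transEnergy_mul_le {p : ℝ} (hp : 1 ≤ p) (v w : G) (F : G → ℂ) :
    transEnergy p (v * w) F ≤
      ((2 : ℝ≥0) ^ (p - 1) : ℝ≥0) * (transEnergy p w F + transEnergy p v F) := by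
  have h : transEnergy p w F = ∑' g, ‖F (g * (v * w)) - F (g * v)‖ₑ ^ p := by
    unfold transEnergy
    rw [← (Equiv.mulRight v).tsum_eq]
    simp [mul_assoc]
  rw [h]
  exact tsum_enorm_sub_rpow_le hp _ _ _

/-- Induction on `w` as a word in the generators; the constant depends on `w` but not on `F`. -/
theorem exists_transEnergy_le {S : Finset G} (hS : IsSymmGen S) {p : ℝ} (hp : 1 ≤ p) (w : G) :
    ∃ C : ℝ≥0, ∀ F : G → ℂ, transEnergy p w F ≤ C * energy S p F := by
  have hw : w ∈ Subgroup.closure (S : Set G) := by rw [hS.closure_eq_top]; trivial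
  induction hw using Subgroup.closure_induction with
  | mem s hs =>
    refine ⟨1, fun F => ?_⟩
    rw [← transEnergy_inv, ENNReal.coe_one, one_mul]
    exact Finset.single_le_sum (f := fun s => transEnergy p s⁻¹ F) (fun _ _ => zero_le) hs
  | one => exact ⟨0, fun F => by simp [transEnergy_one hp]⟩
  | mul v w _ _ hv hw =>
    obtain ⟨A, hA⟩ := hv
    obtain ⟨B, hB⟩ := hw
    refine ⟨(2 : ℝ≥0) ^ (p - 1) * (B + A), fun F => (transEnergy_mul_le hp v w F).trans ?_⟩
    rw [ENNReal.coe_mul, ENNReal.coe_add, mul_assoc, add_mul]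
    gcongr
    exacts [hB F, hA F]
  | inv v _ hv => simpa only [transEnergy_inv] using hv

/-- With a representative `r y` chosen in each nonempty fibre, `g` is determined by `φ g` and `(r (φ
g))⁻¹ * g ∈ B`, so `G` embeds in `Y × B`. -/
theorem tsum_comp_le_of_fiber {Y : Type*} {φ : G → Y} {B : Finset G}
    (hB : ∀ g g', φ g = φ g' → g⁻¹ * g' ∈ B) (A : Y → ℝ≥0∞) :
    ∑' g, A (φ g) ≤ (B.card : ℝ≥0) * ∑' h, A h := by
  classical
  let r : Y → G := Function.invFun φ
  have hr (g : G) : φ (r (φ g)) = φ g := Function.invFun_eq ⟨g, rfl⟩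
  let e : G → Y × B := fun g => (φ g, ⟨(r (φ g))⁻¹ * g, hB _ _ (hr g)⟩)
  have he : Function.Injective e := by
    intro g g' h
    simp only [e, Prod.mk.injEq, Subtype.mk.injEq] at h
    rw [h.1] at h
    exact mul_left_cancel h.2
  refine (ENNReal.tsum_comp_le_tsum_of_injective he fun x => A x.1).trans_eq ?_
  rw [ENNReal.tsum_prod']
  simp [tsum_fintype, ENNReal.tsum_mul_left]

/-- If `τ` is at bounded distance from the map `φ`, whose fibres are uniformly finite, then
`F ∘ τ - F ∘ φ` is controlled in `ℓ^p` by the energy of `F`. -/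
theorem exists_tsum_enorm_sub_le {T : Finset H} (hT : IsSymmGen T) {p : ℝ} (hp : 1 ≤ p)
    {φ τ : G → H} {B : Finset G} (hB : ∀ g g', φ g = φ g' → g⁻¹ * g' ∈ B)
    (hτ : (Set.range fun g => (φ g)⁻¹ * τ g).Finite) :
    ∃ C : ℝ≥0, ∀ F : H → ℂ, ∑' g, ‖F (τ g) - F (φ g)‖ₑ ^ p ≤ C * energy T p F := by
  choose C hC using exists_transEnergy_le hT hp
  refine ⟨∑ w ∈ hτ.toFinset, B.card * C w, fun F => ?_⟩
  calc ∑' g, ‖F (τ g) - F (φ g)‖ₑ ^ p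
      -- The actual displacement at `g` is one of the finitely many `w`; summing over all of them
      -- removes its dependence on `g`.
      ≤ ∑' g, ∑ w ∈ hτ.toFinset, ‖F (φ g * w) - F (φ g)‖ₑ ^ p := by
        refine ENNReal.tsum_le_tsum fun g => ?_
        have := Finset.single_le_sum (f := fun w => ‖F (φ g * w) - F (φ g)‖ₑ ^ p)
          (fun _ _ => zero_le) (hτ.mem_toFinset.2 ⟨g, rfl⟩)
        simpa using this
    _ = ∑ w ∈ hτ.toFinset, ∑' g, ‖F (φ g * w) - F (φ g)‖ₑ ^ p :=
        Summable.tsum_finsetSum fun _ _ => ENNReal.summable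
    _ ≤ ∑ w ∈ hτ.toFinset, (B.card * C w : ℝ≥0) * energy T p F := by
        refine Finset.sum_le_sum fun w _ => ?_
        refine (tsum_comp_le_of_fiber hB fun h => ‖F (h * w) - F h‖ₑ ^ p).trans ?_
        rw [ENNReal.coe_mul, mul_assoc]
        gcongr
        exact hC w F
    _ = _ := by rw [← Finset.sum_mul, ENNReal.ofNNReal_finsetSum]

/-- Passing to `ℝ≥0∞` frees the estimates from summability side conditions. -/
theorem memDp_iff (S : Finset G) {p : ℝ} (hp : 1 ≤ p) (F : G → ℂ) :
    MemDp S p F ↔ energy S p F ≠ ∞ := by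
  have key (s : G) : (Summable fun g : G => ‖F (g * s⁻¹) - F g‖ ^ p) ↔
      transEnergy p s⁻¹ F ≠ ∞ := by
    have h : transEnergy p s⁻¹ F = ∑' g, ENNReal.ofReal (‖F (g * s⁻¹) - F g‖ ^ p) :=
      tsum_congr fun g => by
        rw [← ofReal_norm, ENNReal.ofReal_rpow_of_nonneg (norm_nonneg _) (by linarith)]
    rw [h]
    refine ⟨fun hs => hs.tsum_ofReal_ne_top, fun hs => ?_⟩
    refine (ENNReal.summable_toReal hs).congr fun g => ?_
    rw [ENNReal.toReal_ofReal (by positivity)]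
  simp [MemDp, energy, key, ENNReal.sum_eq_top]

theorem dpNorm_eq {S : Finset G} {p : ℝ} (hp : 1 ≤ p) {F : G → ℂ} (hF : MemDp S p F) :
    dpNorm S p F = (normPow S p F).toReal ^ (1 / p) := by
  have hE := (memDp_iff S hp F).1 hF
  unfold dpNorm normPow
  rw [ENNReal.toReal_add hE (by finiteness), energy, ENNReal.toReal_sum]
  · congr 2
    · refine Finset.sum_congr rfl fun s _ => ?_
      rw [transEnergy, ENNReal.tsum_toReal_eq (by finiteness)]
      simp [← ENNReal.toReal_rpow]
    · simp [← ENNReal.toReal_rpow]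
  · intro s hs
    exact (ENNReal.sum_ne_top.1 hE) s hs

theorem dpNorm_lt_iff {S : Finset G} {p : ℝ} (hp : 1 ≤ p) {F : G → ℂ} (hF : MemDp S p F)
    {ε : ℝ} (hε : 0 < ε) : dpNorm S p F < ε ↔ normPow S p F < ENNReal.ofReal (ε ^ p) := by
  have hE := (memDp_iff S hp F).1 hF
  have hN : normPow S p F ≠ ∞ := by unfold normPow; finiteness
  rw [dpNorm_eq hp hF, ENNReal.lt_ofReal_iff_toReal_lt hN, one_div,
    Real.rpow_inv_lt_iff_of_pos ENNReal.toReal_nonneg hε.le (by linarith)]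

/-- Right translations are isometries of `ℓ^p`, so difference operators are bounded on it. -/
theorem exists_normPow_le_tsum (S : Finset G) {p : ℝ} (hp : 1 ≤ p) :
    ∃ C : ℝ≥0, ∀ F : G → ℂ, normPow S p F ≤ C * ∑' g, ‖F g‖ₑ ^ p := by
  refine ⟨S.card * ((2 : ℝ≥0) ^ (p - 1) * (1 + 1)) + 1, fun F => ?_⟩
  have h1 : ‖F 1‖ₑ ^ p ≤ ∑' g, ‖F g‖ₑ ^ p := ENNReal.le_tsum (f := fun g => ‖F g‖ₑ ^ p) 1
  have h2 (s : G) : transEnergy p s F ≤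
      ((2 : ℝ≥0) ^ (p - 1) * (1 + 1) : ℝ≥0) * ∑' g, ‖F g‖ₑ ^ p := by
    refine (tsum_enorm_sub_rpow_le hp (fun g => F (g * s)) (fun _ => 0) F).trans_eq ?_
    have : ∑' g, ‖F (g * s)‖ₑ ^ p = ∑' g, ‖F g‖ₑ ^ p :=
      (Equiv.mulRight s).tsum_eq fun g => ‖F g‖ₑ ^ p
    simp only [sub_zero, zero_sub, enorm_neg, this]
    rw [ENNReal.coe_mul, mul_assoc, ENNReal.coe_add, ENNReal.coe_one, add_mul, one_mul]
  rw [ENNReal.coe_add, add_mul, ENNReal.coe_one, one_mul]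
  refine add_le_add ?_ h1
  refine (Finset.sum_le_card_nsmul _ _ _ fun s _ => h2 s⁻¹).trans_eq ?_
  rw [nsmul_eq_mul, ENNReal.coe_mul (S.card : ℝ≥0), ENNReal.coe_natCast, mul_assoc]

theorem energy_ne_top_of_tsum_ne_top (S : Finset G) {p : ℝ} (hp : 1 ≤ p) {F : G → ℂ}
    (hF : ∑' g, ‖F g‖ₑ ^ p ≠ ∞) : energy S p F ≠ ∞ := by
  obtain ⟨C, hC⟩ := exists_normPow_le_tsum S hp
  exact ne_top_of_le_ne_top (ENNReal.mul_ne_top ENNReal.coe_ne_top hF)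
    ((self_le_add_right _ _).trans (hC F))

theorem tsum_enorm_rpow_ne_top_of_finite {ι : Type*} {p : ℝ} (hp : 1 ≤ p) {u : ι → ℂ}
    (hu : u.support.Finite) : ∑' g, ‖u g‖ₑ ^ p ≠ ∞ := by
  have h0 : 0 < p := by linarith
  rw [tsum_eq_sum (s := hu.toFinset)]
  · exact ENNReal.sum_ne_top.2 fun _ _ => by finiteness
  · intro g hg
    have : u g = 0 := by simpa using hg
    simp [this, h0]

theorem MemDp.sub {S : Finset G} {p : ℝ} (hp : 1 ≤ p) {f u : G → ℂ}
    (hf : MemDp S p f) (hu : MemDp S p u) : MemDp S p (f - u) := fun s hs => by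
  refine (summable_norm_add hp (hf s hs) (b := fun g => -(u (g * s⁻¹) - u g))
    (by simpa only [norm_neg] using hu s hs)).congr fun g => ?_
  simp only [Pi.sub_apply]
  congr 2
  ring

theorem memClosureFinSupp_iff (S : Finset G) {p : ℝ} (hp : 1 ≤ p) (f : G → ℂ) :
    MemClosureFinSupp S p f ↔ MemDp S p f ∧
      ∀ ε : ℝ≥0∞, ε ≠ 0 → ∃ u : G → ℂ, u.support.Finite ∧ normPow S p (f - u) < ε := by
  have h0 : 0 < p := by linarith
  refine and_congr_right fun hf => ?_
  have hfu {u : G → ℂ} (hu : u.support.Finite) : MemDp S p (f - u) := hf.sub hp <|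
    (memDp_iff S hp u).2
      (energy_ne_top_of_tsum_ne_top S hp (tsum_enorm_rpow_ne_top_of_finite hp hu))
  constructor
  · intro h ε hε
    -- `ε` may be `∞`; the cap makes it a real radius.
    have hm : min ε 1 ≠ ∞ := (min_le_right _ _).trans_lt ENNReal.one_lt_top |>.ne
    have hpos : 0 < (min ε 1).toReal := ENNReal.toReal_pos (by simp [hε]) hm
    obtain ⟨u, hu, hlt⟩ := h ((min ε 1).toReal ^ (1 / p)) (by positivity)
    refine ⟨u, hu, ?_⟩
    rw [dpNorm_lt_iff hp (hfu hu) (by positivity), ← Real.rpow_mul hpos.le,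
      one_div_mul_cancel h0.ne', Real.rpow_one, ENNReal.ofReal_toReal hm] at hlt
    exact hlt.trans_le (min_le_left _ _)
  · intro h ε hε
    obtain ⟨u, hu, hlt⟩ := h (ENNReal.ofReal (ε ^ p)) (by simp; positivity)
    exact ⟨u, hu, (dpNorm_lt_iff hp (hfu hu) hε).2 hlt⟩

/-- `ℓ^p` functions are `D_p`-limits of finitely supported ones. -/
theorem memClosureFinSupp_of_tsum_ne_top (S : Finset G) {p : ℝ} (hp : 1 ≤ p) {f : G → ℂ}
    (hf : ∑' g, ‖f g‖ₑ ^ p ≠ ∞) : MemClosureFinSupp S p f := by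
  classical
  have h0 : 0 < p := by linarith
  refine (memClosureFinSupp_iff S hp f).2
    ⟨(memDp_iff S hp f).2 (energy_ne_top_of_tsum_ne_top S hp hf), fun ε hε => ?_⟩
  obtain ⟨C, hC⟩ := exists_normPow_le_tsum S hp
  have hδ : ε / C ≠ 0 := (ENNReal.div_pos hε ENNReal.coe_ne_top).ne'
  obtain ⟨A, hA⟩ := ((tendsto_order.1 (ENNReal.tendsto_tsum_compl_atTop_zero hf)).2 _
    hδ.bot_lt).exists
  -- Truncate `f` to a finite set outside which its `ℓ^p` mass is below `ε / C`.
  refine ⟨(A : Set G).indicator f,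
    A.finite_toSet.subset Set.support_indicator_subset, ?_⟩
  refine (hC _).trans_lt (ENNReal.mul_lt_of_lt_div' (hA.trans_eq' ?_))
  rw [← tsum_subtype_eq_of_support_subset (s := {x | x ∉ A})]
  · refine tsum_congr fun ⟨g, hg⟩ => ?_
    have : g ∉ A := hg
    simp [this]
  · intro g hg hgA
    simp [hgA, h0] at hg

theorem memClosureFinSupp_of_finite (S : Finset G) {p : ℝ} (hp : 1 ≤ p) {u : G → ℂ}
    (hu : u.support.Finite) : MemClosureFinSupp S p u :=
  memClosureFinSupp_of_tsum_ne_top S hp (tsum_enorm_rpow_ne_top_of_finite hp hu)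

end Energy

end PHarmonic

namespace PHarmonic

/-! ### Coarse geometry of word metrics -/

section Coarse

variable {G : Type*} [Group G] {H : Type*} [Group H]

/-- A map between groups which displaces generators by boundedly many elements and whose fibres
are uniformly finite. -/
structure IsTame (S : Finset G) (φ : G → H) : Prop where
  finite_range : ∀ s ∈ S, (Set.range fun g => (φ g)⁻¹ * φ (g * s⁻¹)).Finite
  fiber : ∃ B : Finset G, ∀ g g', φ g = φ g' → g⁻¹ * g' ∈ B

/-- Graph distance is `0` by convention between unreachable vertices, so connectedness is what makes
the word metric meaningful. -/
theorem IsSymmGen.connected {S : Finset G} (hS : IsSymmGen S) :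
    (SimpleGraph.mulCayley (S : Set G)).Connected := by
  have h1 (w : G) : ∀ g : G, (SimpleGraph.mulCayley (S : Set G)).Reachable g (g * w) := by
    have hw : w ∈ Subgroup.closure (S : Set G) := by rw [hS.closure_eq_top]; trivial
    induction hw using Subgroup.closure_induction with
    | mem s hs =>
      intro g
      by_cases h : g = g * s
      · rw [← h]
      · refine SimpleGraph.Adj.reachable ((SimpleGraph.mulCayley_adj _ _ _).2 ⟨h, Or.inl ?_⟩)
        simpa using hs
    | one => intro g; simp
    | mul v w _ _ hv hw =>
      intro g
      rw [← mul_assoc]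
      exact (hv g).trans (hw _)
    | inv v _ hv =>
      intro g
      simpa using (hv (g * v⁻¹)).symm
  refine ⟨fun g h => ?_⟩
  simpa using h1 (g⁻¹ * h) g

/-- Such `w` are words of length at most `⌊R⌋₊` in a finite alphabet. -/
theorem finite_setOf_inv_mul_eq {S : Finset G} (hS : IsSymmGen S) (R : ℝ) :
    {w : G | ∃ g h, wordDist S g h ≤ R ∧ g⁻¹ * h = w}.Finite := by
  classical
  have key (n : ℕ) :
      {w : G | ∃ g h, ∃ q : (SimpleGraph.mulCayley (S : Set G)).Walk g h,
        q.length ≤ n ∧ g⁻¹ * h = w}.Finite := by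
    induction n with
    | zero =>
      refine (Set.finite_singleton (1 : G)).subset ?_
      rintro w ⟨g, h, q, hq, rfl⟩
      have := SimpleGraph.Walk.eq_of_length_eq_zero (Nat.le_zero.1 hq)
      simp [this]
    | succ n ih =>
      refine ((Set.finite_singleton (1 : G)).union
        (Set.Finite.image2 (· * ·) S.finite_toSet ih)).subset ?_
      rintro w ⟨g, h, q, hq, rfl⟩
      cases q with
      | nil => left; simp
      | @cons _ k _ hadj q =>
        right
        refine ⟨g⁻¹ * k, ?_, k⁻¹ * h, ⟨k, h, q, by simpa using hq, rfl⟩, by simp [mul_assoc]⟩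
        rcases ((SimpleGraph.mulCayley_adj _ _ _).1 hadj).2 with h | h
        · exact h
        · simpa using hS.inv_mem _ h
  refine (key ⌊R⌋₊).subset ?_
  rintro w ⟨g, h, hR, rfl⟩
  obtain ⟨q, hq⟩ := hS.connected.exists_walk_length_eq_dist g h
  exact ⟨g, h, q, hq ▸ Nat.le_floor hR, rfl⟩

theorem finite_range_of_wordDist_le {S : Finset G} (hS : IsSymmGen S) {ι : Type*} {R : ℝ}
    {φ τ : ι → G} (h : ∀ i, wordDist S (φ i) (τ i) ≤ R) :
    (Set.range fun i => (φ i)⁻¹ * τ i).Finite :=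
  (finite_setOf_inv_mul_eq hS R).subset (by rintro _ ⟨i, rfl⟩; exact ⟨_, _, h i, rfl⟩)

theorem wordDist_triangle {S : Finset G} (hS : IsSymmGen S) (x y z : G) :
    wordDist S x z ≤ wordDist S x y + wordDist S y z := by
  unfold wordDist
  exact_mod_cast hS.connected.dist_triangle

theorem wordDist_comm (S : Finset G) (x y : G) : wordDist S x y = wordDist S y x := by
  rw [wordDist, SimpleGraph.dist_comm]
  rfl

theorem wordDist_self (S : Finset G) (x : G) : wordDist S x x = 0 := by
  simp [wordDist]

theorem wordDist_mul_inv_le_one {S : Finset G} {s : G} (hs : s ∈ S) (g : G) :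
    wordDist S g (g * s⁻¹) ≤ 1 := by
  by_cases h : g = g * s⁻¹
  · rw [← h, wordDist_self]; exact zero_le_one
  · have : (SimpleGraph.mulCayley (S : Set G)).Adj g (g * s⁻¹) :=
      (SimpleGraph.mulCayley_adj _ _ _).2 ⟨h, Or.inr (by simpa using hs)⟩
    rw [wordDist, SimpleGraph.dist_eq_one_iff_adj.2 this, Nat.cast_one]

theorem isTame_of_wordDist_le {S : Finset G} {T : Finset H} (hS : IsSymmGen S)
    (hT : IsSymmGen T) {φ : G → H} {K L : ℝ}
    (h1 : ∀ g, ∀ s ∈ S, wordDist T (φ g) (φ (g * s⁻¹)) ≤ K)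
    (h2 : ∀ g g', φ g = φ g' → wordDist S g g' ≤ L) : IsTame S φ where
  finite_range s hs := finite_range_of_wordDist_le hT fun g => h1 g s hs
  fiber := ⟨(finite_setOf_inv_mul_eq hS L).toFinset, fun g g' h =>
    (Set.Finite.mem_toFinset _).2 ⟨g, g', h2 g g' h, rfl⟩⟩

/-- A rough isometry of finitely generated groups is tame and has a tame rough inverse. -/
theorem IsRoughIsometry.exists_tame_inverse {S : Finset G} {T : Finset H} (hS : IsSymmGen S)
    (hT : IsSymmGen T) {φ : G → H} (hφ : IsRoughIsometry (wordDist S) (wordDist T) φ) :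
    IsTame S φ ∧ ∃ ψ : H → G, IsTame T ψ ∧
      (Set.range fun g => g⁻¹ * ψ (φ g)).Finite ∧
      (Set.range fun h => h⁻¹ * φ (ψ h)).Finite := by
  obtain ⟨⟨a, b, ha, hb, hab⟩, c, hc, hsurj⟩ := hφ
  have ha0 : 0 < a := by linarith
  have hlow (x y : G) : wordDist S x y ≤ a * (wordDist T (φ x) (φ y) + b) := by
    have h := (hab x y).1
    rw [one_div, sub_le_iff_le_add, inv_mul_le_iff₀ ha0] at h
    exact h
  choose ψ hψ using hsurj
  refine ⟨isTame_of_wordDist_le hS hT (K := a * 1 + b) (L := a * (0 + b)) ?_ ?_, ψ,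
    -- `φ ∘ ψ` moves points by less than `c`: neighbours end up within `c + 1 + c`, and points with
    -- the same `ψ`-image are within `c + c`.
    isTame_of_wordDist_le hT hS (K := a * (c + 1 + c + b)) (L := c + c) ?_ ?_,
    finite_range_of_wordDist_le hS (R := a * (c + b)) ?_,
    finite_range_of_wordDist_le hT (R := c) ?_⟩
  · intro g s hs
    have := mul_le_mul_of_nonneg_left (wordDist_mul_inv_le_one hs g) ha0.le
    linarith [(hab g (g * s⁻¹)).2]
  · intro g g' h
    have := hlow g g'
    rwa [h, wordDist_self] at this
  · intro h t ht
    refine (hlow _ _).trans (mul_le_mul_of_nonneg_left ?_ ha0.le)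
    have h1 := wordDist_triangle hT (φ (ψ h)) h (φ (ψ (h * t⁻¹)))
    have h2 := wordDist_triangle hT h (h * t⁻¹) (φ (ψ (h * t⁻¹)))
    rw [wordDist_comm T (h * t⁻¹)] at h2
    linarith [hψ h, hψ (h * t⁻¹), wordDist_mul_inv_le_one ht h]
  · intro h h' e
    have h1 := wordDist_triangle hT h (φ (ψ h)) h'
    rw [wordDist_comm T h (φ (ψ h))] at h1
    have h2 := hψ h'
    rw [← e] at h2
    linarith [hψ h]
  · intro g
    rw [wordDist_comm]
    exact (hlow _ _).trans (mul_le_mul_of_nonneg_left (by linarith [hψ (φ g)]) ha0.le)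
  · intro h
    rw [wordDist_comm]
    exact (hψ h).le

end Coarse

/-! ### Pullback of functions and the induced maps of spectra -/

section Pullback

variable {G : Type*} [Group G] {H : Type*} [Group H] {S : Finset G} {T : Finset H} {p : ℝ}
  {φ : G → H}

theorem IsTame.exists_energy_comp_le (hφ : IsTame S φ) (hT : IsSymmGen T) (hp : 1 ≤ p) :
    ∃ C : ℝ≥0, ∀ F : H → ℂ, energy S p (F ∘ φ) ≤ C * energy T p F := by
  obtain ⟨B, hB⟩ := hφ.fiber
  choose C hC using fun s : S =>
    exists_tsum_enorm_sub_le hT hp hB (hφ.finite_range s s.2)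
  refine ⟨∑ s : S, C s, fun F => ?_⟩
  rw [energy, ← Finset.sum_coe_sort, ENNReal.ofNNReal_finsetSum, Finset.sum_mul]
  exact Finset.sum_le_sum fun s _ => hC s F

theorem IsTame.memDp_comp (hφ : IsTame S φ) (hT : IsSymmGen T) (hp : 1 ≤ p) {F : H → ℂ}
    (hF : MemDp T p F) : MemDp S p (F ∘ φ) := by
  obtain ⟨C, hC⟩ := hφ.exists_energy_comp_le hT hp
  rw [memDp_iff _ hp] at hF ⊢
  exact ne_top_of_le_ne_top (ENNReal.mul_ne_top ENNReal.coe_ne_top hF) (hC F)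

theorem IsTame.exists_normPow_comp_le (hφ : IsTame S φ) (hT : IsSymmGen T) (hp : 1 ≤ p) :
    ∃ C : ℝ≥0, ∀ F : H → ℂ, normPow S p (F ∘ φ) ≤ C * normPow T p F := by
  obtain ⟨A, hA⟩ := hφ.exists_energy_comp_le hT hp
  -- `φ 1` need not be `1`; the change of base point is a single term of the translation energy
  -- along `φ 1`.
  obtain ⟨B, hB⟩ := exists_transEnergy_le hT hp (φ 1)
  set K : ℝ≥0 := (2 : ℝ≥0) ^ (p - 1)
  refine ⟨A + K * (B + 1), fun F => ?_⟩
  have h1 : ‖F (φ 1) - F 1‖ₑ ^ p ≤ B * energy T p F := by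
    refine le_trans ?_ (hB F)
    simpa [transEnergy] using ENNReal.le_tsum (f := fun h => ‖F (h * φ 1) - F h‖ₑ ^ p) 1
  have h2 : ‖F (φ 1)‖ₑ ^ p ≤ K * (‖F (φ 1) - F 1‖ₑ ^ p + ‖F 1‖ₑ ^ p) := by
    simpa using enorm_sub_rpow_le hp (F (φ 1)) (F 1) 0
  have hE : energy T p F ≤ normPow T p F := self_le_add_right _ _
  have h1' : ‖F 1‖ₑ ^ p ≤ normPow T p F := self_le_add_left _ _
  calc normPow S p (F ∘ φ)
      ≤ A * normPow T p F + K * (B * normPow T p F + normPow T p F) := by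
        refine add_le_add ((hA F).trans (by gcongr)) (h2.trans ?_)
        gcongr
        exact h1.trans (by gcongr)
    _ = _ := by push_cast; ring

theorem IsTame.memClosureFinSupp_comp (hφ : IsTame S φ) (hT : IsSymmGen T) (hp : 1 ≤ p)
    {F : H → ℂ} (hF : MemClosureFinSupp T p F) : MemClosureFinSupp S p (F ∘ φ) := by
  obtain ⟨C, hC⟩ := hφ.exists_normPow_comp_le hT hp
  rw [memClosureFinSupp_iff _ hp] at hF ⊢
  refine ⟨hφ.memDp_comp hT hp hF.1, fun ε hε => ?_⟩
  obtain ⟨u, hu, hlt⟩ := hF.2 (ε / C) (ENNReal.div_pos hε ENNReal.coe_ne_top).ne'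
  refine ⟨u ∘ φ, ?_, (hC (F - u)).trans_lt (ENNReal.mul_lt_of_lt_div' hlt)⟩
  obtain ⟨B, hB⟩ := hφ.fiber
  rw [Function.support_comp_eq_preimage]
  refine hu.preimage' fun h _ => ?_
  rcases (φ ⁻¹' {h}).eq_empty_or_nonempty with he | ⟨g, hg⟩
  · rw [he]; exact Set.finite_empty
  · refine (B.finite_toSet.image (g * ·)).subset fun g' hg' => ⟨g⁻¹ * g', ?_, by simp⟩
    exact hB _ _ ((Set.mem_singleton_iff.1 hg).trans (Set.mem_singleton_iff.1 hg').symm)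

/-- Composition with a tame map, as a homomorphism `BD_p(H) → BD_p(G)`. -/
def IsTame.pullback (hφ : IsTame S φ) (hT : IsSymmGen T) (hp : 1 ≤ p) :
    BD T hp →ₙₐ[ℂ] BD S hp where
  toFun f := ⟨(f : H → ℂ) ∘ φ, f.2.1.imp fun _ h g => h (φ g), hφ.memDp_comp hT hp f.2.2⟩
  map_smul' _ _ := rfl
  map_zero' := rfl
  map_add' _ _ := rfl
  map_mul' _ _ := rfl

theorem Spec.map_one {hp : 1 ≤ p} (x : Spec S hp) : x.1 1 = 1 := by
  obtain ⟨f, hf⟩ : ∃ f, x.1 f ≠ 0 := by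
    by_contra! h
    exact x.2 (NonUnitalAlgHom.ext h)
  have : x.1 f * x.1 1 = x.1 f * 1 := by rw [← _root_.map_mul, mul_one, mul_one]
  exact mul_left_cancel₀ hf this

/-- The map of spectra induced by a tame map. -/
def IsTame.specMap (hφ : IsTame S φ) (hT : IsSymmGen T) (hp : 1 ≤ p) (x : Spec S hp) :
    Spec T hp :=
  ⟨x.1.comp (hφ.pullback hT hp), fun h => one_ne_zero (α := ℂ) <|
    x.map_one.symm.trans (DFunLike.congr_fun h (1 : BD T hp))⟩

theorem tendsto_spec_iff {hp : 1 ≤ p} {ι : Type*} {F : Filter ι} {y : ι → Spec S hp}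
    {x : Spec S hp} :
    Tendsto y F (𝓝 x) ↔ ∀ f : BD S hp, Tendsto (fun i => (y i).1 f) F (𝓝 (x.1 f)) := by
  rw [nhds_induced, tendsto_comap_iff, tendsto_pi_nhds]
  rfl

theorem IsTame.continuous_specMap (hφ : IsTame S φ) (hT : IsSymmGen T) (hp : 1 ≤ p) :
    Continuous (hφ.specMap hT hp) :=
  continuous_iff_continuousAt.2 fun _ => tendsto_spec_iff.2 fun f =>
    tendsto_spec_iff.1 tendsto_id (hφ.pullback hT hp f)

/-- Point evaluations are excluded automatically: evaluation at `g` does not kill the indicator of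
`{g}`. -/
theorem mem_boundary_iff {hp : 1 ≤ p} (x : Spec S hp) :
    x ∈ boundary S hp ↔ ∀ f : BD S hp, MemClosureFinSupp S p (f : G → ℂ) → x.1 f = 0 := by
  classical
  refine ⟨fun h => h.2, fun h => ⟨?_, h⟩⟩
  rintro ⟨g, rfl⟩
  have hδ : MemClosureFinSupp S p (Pi.single g (1 : ℂ)) :=
    memClosureFinSupp_of_finite S hp ((Set.finite_singleton g).subset Pi.support_single_subset)
  have hb : ∀ k, ‖(Pi.single g (1 : ℂ) : G → ℂ) k‖ ≤ 1 := by
    intro k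
    by_cases hk : k = g
    · subst hk; simp
    · simp [hk]
  have h0 : (Pi.single g (1 : ℂ) : G → ℂ) g = 0 := h ⟨_, ⟨1, hb⟩, hδ.1⟩ hδ
  simp at h0

theorem IsTame.specMap_mem_boundary (hφ : IsTame S φ) (hT : IsSymmGen T) (hp : 1 ≤ p)
    {x : Spec S hp} (hx : x ∈ boundary S hp) : hφ.specMap hT hp x ∈ boundary T hp := by
  rw [mem_boundary_iff] at hx ⊢
  exact fun f hf => hx _ (hφ.memClosureFinSupp_comp hT hp hf)

/-- On the boundary, a rough inverse induces the inverse map. -/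
theorem IsTame.specMap_specMap (hφ : IsTame S φ) (hS : IsSymmGen S) (hT : IsSymmGen T)
    (hp : 1 ≤ p) {ψ : H → G} (hψ : IsTame T ψ) (hψφ : (Set.range fun g => g⁻¹ * ψ (φ g)).Finite)
    {x : Spec S hp} (hx : x ∈ boundary S hp) :
    hψ.specMap hS hp (hφ.specMap hT hp x) = x := by
  refine Subtype.ext (NonUnitalAlgHom.ext fun f => ?_)
  change x.1 (hφ.pullback hT hp (hψ.pullback hS hp f)) = x.1 f
  rw [← sub_eq_zero, ← map_sub]
  refine (mem_boundary_iff x).1 hx _ (memClosureFinSupp_of_tsum_ne_top S hp ?_)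
  -- The identity has singleton fibres, hence `B = {1}`.
  obtain ⟨C, hC⟩ := exists_tsum_enorm_sub_le hS hp (φ := id) (τ := fun g => ψ (φ g)) (B := {1})
    (by rintro g _ rfl; simp) hψφ
  exact ne_top_of_le_ne_top
    (ENNReal.mul_ne_top ENNReal.coe_ne_top ((memDp_iff S hp _).1 f.2.2)) (hC f)

end Pullback

end PHarmonic

theorem theorem2p3 {G : Type*} {H : Type*} [Group G] [Group H]
    (S : Finset G) (T : Finset H) (hS : PHarmonic.IsSymmGen S) (hT : PHarmonic.IsSymmGen T)
    {p : ℝ} (hp : 1 ≤ p) (φ : G → H)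
    (hφ : PHarmonic.IsRoughIsometry (PHarmonic.wordDist S) (PHarmonic.wordDist T) φ) :
    ∃ Φ : PHarmonic.boundary S hp ≃ₜ PHarmonic.boundary T hp,
      ∀ (x : PHarmonic.boundary S hp) (F : Filter G),
        Tendsto (PHarmonic.toSpec S hp) F (𝓝 (x : PHarmonic.Spec S hp)) →
        Tendsto (fun g => PHarmonic.toSpec T hp (φ g)) F
          (𝓝 (Φ x : PHarmonic.Spec T hp)) := by
  obtain ⟨hφt, ψ, hψt, hψφ, hφψ⟩ := hφ.exists_tame_inverse hS hT
  refine ⟨{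
    toFun := fun x => ⟨hφt.specMap hT hp x, hφt.specMap_mem_boundary hT hp x.2⟩
    invFun := fun y => ⟨hψt.specMap hS hp y, hψt.specMap_mem_boundary hS hp y.2⟩
    left_inv := fun x => Subtype.ext (hφt.specMap_specMap hS hT hp hψt hψφ x.2)
    right_inv := fun y => Subtype.ext (hψt.specMap_specMap hT hS hp hφt hφψ y.2)
    continuous_toFun :=
      ((hφt.continuous_specMap hT hp).comp continuous_subtype_val).subtype_mk _
    continuous_invFun :=
      ((hψt.continuous_specMap hS hp).comp continuous_subtype_val).subtype_mk _ }, ?_⟩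
  intro x F hF
  -- By definition `specMap` sends evaluation at `g` to evaluation at `φ g`, so continuity suffices.
  exact ((hφt.continuous_specMap hT hp).tendsto (x : PHarmonic.Spec S hp)).comp hF
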